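/- Let $d\in\mathbb N$, let $\mu$ be a probability measure on $\mathbb Z^d$ and let $E\subset\mathbb Z^d$. Let $(X(t))_{t\ge 0}$ be the random walk on $\mathbb Z^d$ with transition probabilities $p(x,y)=\mu(y-x)$, killed upon its first exit from $E$, and for $x,y\in E$ let $$Q(x,y)=\mathbb P_x\bigl(X(t)=y\ \text{for some } 0<t<\infty\bigr)$$ be its hitting probabilities. Assume: (C0') The killed walk $(X(t))$ is transient on $E$, i.e. $\sum_{t\ge 0}\mathbb P_x(X(t)=x)<\infty$ for every $x\in E$, and there are $\kappa>0$ and a finite set $\mathcal E_0\subset\mathbb Z^d$ such that (a) $\mu(x)>0$ for all $x\in\mathcal E_0$; (b) for any $x\neq y$ in $E$ there is a sequence $x_0,x_1,\dots,x_n\in E$ with $x_0=x$, $x_n=y$, $n\le\kappa|y-x|$ and $x_j-x_{j-1}\in\mathcal E_0$ for all $j\in\{1,\dots,n\}$. (C1') There is an open convex cone $\mathcal C\subset\mathbb R^d$ with vertex at the origin such that $E=\overline{\mathcal C}\cap\mathbb Z^d$. (C2) The jump generating function $R:\mathbb R^d\to\mathbb R\cup\{+\infty\}$, $R(\alpha)=\sum_{x\in\mathbb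 Z^d}\mu(x)e^{\langle\alpha,x\rangle}$, satisfies $R(\alpha)>R(0)=1$ for every $\alpha\in\mathbb R^d\setminus\{0\}$. Then, for every $u\in E$, the probabilities $Q(x,x+nu)$ and $Q(x+nu,x)$ are positive for all $x\in E$ and $n\ge 1$, and, uniformly in $x\in E$, $$\lim_{n\to\infty}\frac1n\log Q(x,x+nu)=\lim_{n\to\infty}\frac1n\log Q(x+nu,x)=0.$$ -/

import Mathlib

open MeasureTheory Filter Topology

noncomputable section

/-- The lattice `ℤ^d`. -/
abbrev IntLattice (d : ℕ) : Type := Fin d → ℤ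

/-- The embedding of `ℤ^d` into the Euclidean space `ℝ^d`. -/
def latticeToEuclidean {d : ℕ} (x : IntLattice d) : EuclideanSpace ℝ (Fin d) :=
  WithLp.toLp 2 (fun i => (x i : ℝ))

/-- The law of a sequence of independent steps, each distributed according to `μ`. -/
def stepLaw {d : ℕ} (μ : Measure (IntLattice d)) [IsProbabilityMeasure μ] :
    Measure (ℕ → IntLattice d) :=
  Measure.infinitePi (fun _ : ℕ => μ)

/-- The homogeneous random walk `S(t)` on `ℤ^d` started at `x`, as a function of its steps. -/
def freeWalk {d : ℕ} (x : IntLattice d) (ω : ℕ → IntLattice d) (t : ℕ) : IntLattice d :=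
  x + ∑ i ∈ Finset.range t, ω i

open Classical in
/-- The walk `X(t)` started at `x` and killed upon its first exit from `E`;
`none` is the absorbing cemetery state. -/
def killedWalk {d : ℕ} (E : Set (IntLattice d)) (x : IntLattice d) (ω : ℕ → IntLattice d) (t : ℕ) :
    Option (IntLattice d) :=
  if ∀ s ≤ t, freeWalk x ω s ∈ E then some (freeWalk x ω t) else none

/-- The Green function `G(x, y) = ∑_{t ≥ 0} ℙ_x(X(t) = y)` of the killed walk. -/
def greenFunction {d : ℕ} (μ : Measure (IntLattice d)) [IsProbabilityMeasure μ]
    (E : Set (IntLattice d)) (x y : IntLattice d) : ENNReal :=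
  ∑' t : ℕ, stepLaw μ {ω | killedWalk E x ω t = some y}

/-- The hitting probability `Q(x, y) = ℙ_x(X(t) = y for some 0 < t < ∞)` of the killed walk. -/
def hittingProb {d : ℕ} (μ : Measure (IntLattice d)) [IsProbabilityMeasure μ]
    (E : Set (IntLattice d)) (x y : IntLattice d) : ℝ :=
  (stepLaw μ).real {ω | ∃ t : ℕ, 0 < t ∧ killedWalk E x ω t = some y}

/-- Every state of `E` is transient for the killed walk. -/
def IsTransientOn {d : ℕ} (μ : Measure (IntLattice d)) [IsProbabilityMeasure μ]
    (E : Set (IntLattice d)) : Prop :=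
  ∀ x ∈ E, greenFunction μ E x x < ⊤

/-- The communication condition: any two distinct points `x, y` of `E` are joined by a path
in `E`, of length at most `κ |y - x|`, whose steps belong to a fixed finite set of steps
of positive probability. -/
def Communicates {d : ℕ} (μ : Measure (IntLattice d)) (E : Set (IntLattice d)) : Prop :=
  ∃ (κ : ℝ) (E₀ : Finset (IntLattice d)), 0 < κ ∧ (∀ z ∈ E₀, 0 < μ {z}) ∧
    ∀ x ∈ E, ∀ y ∈ E, x ≠ y →
      ∃ (n : ℕ) (p : ℕ → IntLattice d), p 0 = x ∧ p n = y ∧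
        (n : ℝ) ≤ κ * ‖latticeToEuclidean (y - x)‖ ∧
        (∀ j ≤ n, p j ∈ E) ∧ ∀ j < n, p (j + 1) - p j ∈ E₀

/-- `E` consists of the lattice points of the closure of an open convex cone with vertex `0`. -/
def IsLatticeCone {d : ℕ} (E : Set (IntLattice d)) : Prop :=
  ∃ C : ConvexCone ℝ (EuclideanSpace ℝ (Fin d)),
    IsOpen (C : Set (EuclideanSpace ℝ (Fin d))) ∧
    E = {x | latticeToEuclidean x ∈ closure (C : Set (EuclideanSpace ℝ (Fin d)))}

/-- The jump generating function `R(α) = ∑_x μ(x) exp ⟨α, x⟩`, with values in `[0, ∞]`. -/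
def jumpGeneratingFunction {d : ℕ} (μ : Measure (IntLattice d))
    (α : EuclideanSpace ℝ (Fin d)) : ENNReal :=
  ∑' x : IntLattice d, μ {x} * ENNReal.ofReal (Real.exp (inner ℝ α (latticeToEuclidean x)))

/-- The jump generating function has a strict global minimum at `0`, with value `1`. -/
def HasStrictMinAtZero {d : ℕ} (μ : Measure (IntLattice d)) : Prop :=
  jumpGeneratingFunction μ 0 = 1 ∧
    ∀ α : EuclideanSpace ℝ (Fin d), α ≠ 0 →
      jumpGeneratingFunction μ 0 < jumpGeneratingFunction μ α

end

/-! Since probabilities are at most 1, only a lower bound is needed: for each `ε > 0`, a constant `c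
> 0` with both hitting probabilities at least `c * exp (-ε n)` for all `n` and all `x ∈ E`. As `E`
is closed under addition, paths translate by `x`, so the case `x = 0` suffices and uniformity comes
for free.

For the free walk, let `unitCostSet` be the directions in which displacement `s • w` costs at most a
factor of order `exp (-s)`, at any time. It is convex and a neighbourhood of 0. Were it not the
whole space, a supporting hyperplane would give `α ≠ 0` with `⟨α, ·⟩ ≤ 1` on it, forcing every
transition probability from 0 to `x` to be at most `exp (-⟨α, x⟩)`. But `R(α) > 1` makes the sum of
the weighted probabilities over a box of polynomial volume grow exponentially
(`exists_one_lt_killedTransition_mul_exp`). So every direction has zero exponential cost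
(`exists_reaches_nsmul`).

To stay in the cone, take one cheap free path to `k • u` or `-(k • u)`, confine it to a box, move
the box to a point `z` deep in `E`, and concatenate translates along the ray
(`exists_reaches_nsmul_of_isLatticeCone`, `exists_reaches_zero_of_isLatticeCone`). -/

variable {d : ℕ}

/-! ### Transition probabilities of the killed walk -/

/-- The `t`-step transition probability `ℙ_x(X(t) = y)` of the walk killed outside `E`. -/
noncomputable def killedTransition (μ : Measure (IntLattice d)) [IsProbabilityMeasure μ]
    (E : Set (IntLattice d)) (t : ℕ) (x y : IntLattice d) : ℝ :=
  (stepLaw μ).real {ω | killedWalk E x ω t = some y}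

instance isProbabilityMeasure_stepLaw (μ : Measure (IntLattice d)) [IsProbabilityMeasure μ] :
    IsProbabilityMeasure (stepLaw μ) := by
  unfold stepLaw; infer_instance

theorem killedWalk_eq_some_iff {E : Set (IntLattice d)} {x y : IntLattice d}
    {ω : ℕ → IntLattice d} {t : ℕ} :
    killedWalk E x ω t = some y ↔ (∀ s ≤ t, freeWalk x ω s ∈ E) ∧ freeWalk x ω t = y := by
  unfold killedWalk
  split_ifs with h
  · exact (Option.some_inj).trans (and_iff_right h).symm
  · simp [h]

theorem freeWalk_congr {x : IntLattice d} {ω ω' : ℕ → IntLattice d} {t : ℕ}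
    (h : ∀ i < t, ω i = ω' i) : freeWalk x ω t = freeWalk x ω' t := by
  unfold freeWalk
  rw [Finset.sum_congr rfl fun i hi => h i (Finset.mem_range.1 hi)]

theorem killedWalk_congr {E : Set (IntLattice d)} {x : IntLattice d}
    {ω ω' : ℕ → IntLattice d} {t : ℕ} (h : ∀ i < t, ω i = ω' i) :
    killedWalk E x ω t = killedWalk E x ω' t := by
  ext y
  simp only [killedWalk_eq_some_iff]
  rw [freeWalk_congr h]
  refine and_congr_left fun _ => forall₂_congr fun s hs => ?_
  rw [freeWalk_congr fun i hi => h i (hi.trans_le hs)]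

theorem freeWalk_add (x : IntLattice d) (ω : ℕ → IntLattice d) (s t : ℕ) :
    freeWalk x ω (s + t) = freeWalk (freeWalk x ω s) (fun i => ω (s + i)) t := by
  unfold freeWalk
  rw [Finset.sum_range_add, add_assoc]

theorem freeWalk_translate (a x : IntLattice d) (ω : ℕ → IntLattice d) (t : ℕ) :
    freeWalk (a + x) ω t = a + freeWalk x ω t := by
  unfold freeWalk
  rw [add_assoc]

theorem killedWalk_add {E : Set (IntLattice d)} {x y z : IntLattice d} {ω : ℕ → IntLattice d}
    {s t : ℕ} (h₁ : killedWalk E x ω s = some y)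
    (h₂ : killedWalk E y (fun i => ω (s + i)) t = some z) :
    killedWalk E x ω (s + t) = some z := by
  rw [killedWalk_eq_some_iff] at *
  obtain ⟨h₁, rfl⟩ := h₁
  refine ⟨fun r hr => ?_, by rw [freeWalk_add, h₂.2]⟩
  rcases le_total r s with h | h
  · exact h₁ r h
  · obtain ⟨q, rfl⟩ := Nat.exists_eq_add_of_le h
    rw [freeWalk_add]
    exact h₂.1 q (by omega)

theorem measurable_freeWalk (x : IntLattice d) (t : ℕ) :
    Measurable fun ω : ℕ → IntLattice d => freeWalk x ω t := by
  unfold freeWalk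
  fun_prop

theorem measurableSet_killedWalk_eq_some (E : Set (IntLattice d)) (x y : IntLattice d) (t : ℕ) :
    MeasurableSet {ω : ℕ → IntLattice d | killedWalk E x ω t = some y} := by
  simp only [killedWalk_eq_some_iff, Set.ofPred_and, Set.ofPred_forall]
  refine .inter (.iInter fun s => .iInter fun _ => ?_) ?_
  · exact measurable_freeWalk x s (Set.to_countable E).measurableSet
  · exact measurable_freeWalk x t (measurableSet_singleton y)

theorem map_shift_stepLaw (μ : Measure (IntLattice d)) [IsProbabilityMeasure μ] (s : ℕ) :
    (stepLaw μ).map (fun ω i => ω (s + i)) = stepLaw μ :=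
  Measure.map_infinitePi_infinitePi_of_inj (P := fun _ : ℕ => μ) (add_right_injective s)

/-- The walk until time `s` is independent of the steps taken afterwards. -/
theorem stepLaw_real_markov (μ : Measure (IntLattice d)) [IsProbabilityMeasure μ]
    (E : Set (IntLattice d)) (s t : ℕ) (x y z : IntLattice d) :
    (stepLaw μ).real ({ω | killedWalk E x ω s = some y} ∩
      {ω | killedWalk E y (fun i => ω (s + i)) t = some z}) =
      killedTransition μ E s x y * killedTransition μ E t y z := by
  set S : Finset ℕ := Finset.range s
  set T : Finset ℕ := Finset.Ico s (s + t)
  -- Each event depends on finitely many steps. Padding with 0 turns it into a subset of a countable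
  -- space, where measurability is automatic.
  let extS : (S → IntLattice d) → ℕ → IntLattice d :=
    fun v i => if h : i ∈ S then v ⟨i, h⟩ else 0
  let extT : (T → IntLattice d) → ℕ → IntLattice d :=
    fun v i => if h : s + i ∈ T then v ⟨s + i, h⟩ else 0
  have hind := (ProbabilityTheory.iIndepFun_infinitePi (P := fun _ : ℕ => μ)
    (X := fun _ ω => ω) (fun _ => measurable_id)).indepFun_finset S T
      (by
        rw [Finset.disjoint_left]
        intro i hi hi'
        simp only [S, T, Finset.mem_range, Finset.mem_Ico] at hi hi'
        omega) (fun i => measurable_pi_apply i)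
  have key := hind.measure_inter_preimage_eq_mul {v | killedWalk E x (extS v) s = some y}
    {v | killedWalk E y (extT v) t = some z} (Set.to_countable _).measurableSet
    (Set.to_countable _).measurableSet
  have e₁ : (fun (ω : ℕ → IntLattice d) (i : S) => ω i) ⁻¹'
      {v | killedWalk E x (extS v) s = some y} = {ω | killedWalk E x ω s = some y} := by
    ext ω
    simp only [Set.mem_preimage, Set.mem_ofPred_eq]
    rw [killedWalk_congr (ω' := ω)]
    intro i hi
    simp [extS, S, hi]
  have e₂ : (fun (ω : ℕ → IntLattice d) (i : T) => ω i) ⁻¹'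
      {v | killedWalk E y (extT v) t = some z} =
      {ω | killedWalk E y (fun i => ω (s + i)) t = some z} := by
    ext ω
    simp only [Set.mem_preimage, Set.mem_ofPred_eq]
    rw [killedWalk_congr (ω' := fun i => ω (s + i))]
    intro i hi
    simp [extT, T, hi]
  have e₃ : stepLaw μ {ω | killedWalk E y (fun i => ω (s + i)) t = some z} =
      stepLaw μ {ω | killedWalk E y ω t = some z} := by
    conv_rhs => rw [← map_shift_stepLaw μ s]
    rw [Measure.map_apply (by fun_prop) (measurableSet_killedWalk_eq_some E y z t)]
    rfl
  rw [e₁, e₂] at key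
  simp only [killedTransition, measureReal_def, ← ENNReal.toReal_mul]
  rw [← e₃]
  exact congrArg ENNReal.toReal key

theorem killedTransition_nonneg (μ : Measure (IntLattice d)) [IsProbabilityMeasure μ]
    (E : Set (IntLattice d)) (t : ℕ) (x y : IntLattice d) : 0 ≤ killedTransition μ E t x y :=
  measureReal_nonneg

/-- One half of Chapman–Kolmogorov: the events with different positions at time `s` are disjoint. -/
theorem sum_killedTransition_mul_le (μ : Measure (IntLattice d)) [IsProbabilityMeasure μ]
    (E : Set (IntLattice d)) (s t : ℕ) (x z : IntLattice d) (F : Finset (IntLattice d)) :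
    ∑ y ∈ F, killedTransition μ E s x y * killedTransition μ E t y z ≤
      killedTransition μ E (s + t) x z := by
  simp only [← stepLaw_real_markov]
  rw [← measureReal_biUnion_finset]
  · refine measureReal_mono (fun ω hω => ?_)
    simp only [Set.mem_iUnion] at hω
    obtain ⟨y, _, h₁, h₂⟩ := hω
    exact killedWalk_add h₁ h₂
  · intro y _ y' _ hne
    refine Set.disjoint_left.2 fun ω h₁ h₂ => hne ?_
    have h₁ := h₁.1
    have h₂ := h₂.1
    simp only [Set.mem_ofPred_eq] at h₁ h₂
    exact Option.some_injective _ (h₁.symm.trans h₂)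
  · intro y _
    refine (measurableSet_killedWalk_eq_some E x y s).inter ?_
    exact (measurable_pi_lambda _ fun i => measurable_pi_apply (s + i) :
      Measurable fun (ω : ℕ → IntLattice d) (i : ℕ) => ω (s + i))
        (measurableSet_killedWalk_eq_some E y z t)

theorem killedTransition_mul_le (μ : Measure (IntLattice d)) [IsProbabilityMeasure μ]
    (E : Set (IntLattice d)) (s t : ℕ) (x y z : IntLattice d) :
    killedTransition μ E s x y * killedTransition μ E t y z ≤
      killedTransition μ E (s + t) x z := by
  simpa using sum_killedTransition_mul_le μ E s t x z {y}

/-- The same steps drive both walks. This carries paths from a box into the cone, and from 0 to any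
`x ∈ E`. -/
theorem killedTransition_le_translate (μ : Measure (IntLattice d)) [IsProbabilityMeasure μ]
    {E F : Set (IntLattice d)} {a : IntLattice d} (h : ∀ w ∈ F, a + w ∈ E) (t : ℕ)
    (x y : IntLattice d) :
    killedTransition μ F t x y ≤ killedTransition μ E t (a + x) (a + y) := by
  refine measureReal_mono fun ω hω => ?_
  simp only [Set.mem_ofPred_eq, killedWalk_eq_some_iff, freeWalk_translate] at hω ⊢
  exact ⟨fun s hs => h _ (hω.1 s hs), by rw [hω.2]⟩

theorem killedTransition_zero (μ : Measure (IntLattice d)) [IsProbabilityMeasure μ]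
    {E : Set (IntLattice d)} {x : IntLattice d} (hx : x ∈ E) : killedTransition μ E 0 x x = 1 := by
  have : {ω : ℕ → IntLattice d | killedWalk E x ω 0 = some x} = Set.univ := by
    ext ω
    simp [killedWalk_eq_some_iff, freeWalk, hx]
  rw [killedTransition, this, probReal_univ]

theorem killedTransition_one (μ : Measure (IntLattice d)) [IsProbabilityMeasure μ]
    {E : Set (IntLattice d)} {x y : IntLattice d} (hx : x ∈ E) (hy : y ∈ E) :
    killedTransition μ E 1 x y = μ.real {y - x} := by
  have : {ω : ℕ → IntLattice d | killedWalk E x ω 1 = some y} =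
      (fun ω => ω 0) ⁻¹' {y - x} := by
    ext ω
    simp only [Set.mem_ofPred_eq, killedWalk_eq_some_iff, Set.mem_preimage, Set.mem_singleton_iff,
      eq_sub_iff_add_eq']
    have h1 : freeWalk x ω 1 = x + ω 0 := by simp [freeWalk]
    have h0 : freeWalk x ω 0 = x := by simp [freeWalk]
    rw [h1]
    refine ⟨fun h => h.2, fun h => ⟨fun s hs => ?_, h⟩⟩
    interval_cases s
    · rwa [h0]
    · rwa [h1, h]
  rw [killedTransition, this, ← map_measureReal_apply (measurable_pi_apply 0)
    (measurableSet_singleton _), stepLaw, Measure.infinitePi_map_eval]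

theorem killedTransition_le_hittingProb (μ : Measure (IntLattice d)) [IsProbabilityMeasure μ]
    (E : Set (IntLattice d)) {t : ℕ} (ht : 0 < t) (x y : IntLattice d) :
    killedTransition μ E t x y ≤ hittingProb μ E x y :=
  measureReal_mono fun _ hω => ⟨t, ht, hω⟩

/-- The walk reaching `y` at time `t` does so within a bounded region with almost the same
probability. -/
theorem exists_lt_killedTransition_box (μ : Measure (IntLattice d)) [IsProbabilityMeasure μ]
    {t : ℕ} {x y : IntLattice d} {c : ℝ} (hc : c < killedTransition μ Set.univ t x y) :
    ∃ r : ℕ, c < killedTransition μ {w | ∀ i, |w i| ≤ r} t x y := by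
  have hmono : Monotone fun r : ℕ => {ω : ℕ → IntLattice d |
      killedWalk {w : IntLattice d | ∀ i, |w i| ≤ r} x ω t = some y} := by
    intro r r' hr ω hω
    simp only [Set.mem_ofPred_eq, killedWalk_eq_some_iff] at hω ⊢
    exact ⟨fun s hs i => (hω.1 s hs i).trans (by exact_mod_cast hr), hω.2⟩
  have hunion : (⋃ r : ℕ, {ω : ℕ → IntLattice d |
      killedWalk {w : IntLattice d | ∀ i, |w i| ≤ r} x ω t = some y}) =
      {ω | killedWalk Set.univ x ω t = some y} := by
    ext ω
    simp only [Set.mem_iUnion, Set.mem_ofPred_eq, killedWalk_eq_some_iff, Set.mem_univ,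
      implies_true, true_and]
    refine ⟨fun ⟨_, h⟩ => h.2, fun h => ?_⟩
    refine ⟨∑ s ∈ Finset.range (t + 1), ∑ i, (freeWalk x ω s i).natAbs, fun s hs i => ?_, h⟩
    rw [Int.abs_eq_natAbs]
    norm_cast
    exact (Finset.single_le_sum (f := fun i => (freeWalk x ω s i).natAbs)
      (fun _ _ => Nat.zero_le _) (Finset.mem_univ i)).trans
      (Finset.single_le_sum (f := fun s => ∑ i, (freeWalk x ω s i).natAbs)
        (fun _ _ => Nat.zero_le _) (Finset.mem_range.2 (by omega)))
  have htend := tendsto_measure_iUnion_atTop (μ := stepLaw μ) hmono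
  rw [hunion] at htend
  have htend' := (ENNReal.tendsto_toReal (measure_ne_top _ _)).comp htend
  exact (htend'.eventually (lt_mem_nhds hc)).exists

/-! ### Calculus of reachability with a probability bound -/

/-- The walk killed outside `E` goes from `x` to `y` with probability at least `c` at some time. -/
def Reaches (μ : Measure (IntLattice d)) [IsProbabilityMeasure μ] (E : Set (IntLattice d))
    (c : ℝ) (x y : IntLattice d) : Prop :=
  ∃ t, c ≤ killedTransition μ E t x y

namespace Reaches

variable {μ : Measure (IntLattice d)} [IsProbabilityMeasure μ] {E F : Set (IntLattice d)}
  {c c' : ℝ} {x y z a : IntLattice d}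

theorem refl (hx : x ∈ E) : Reaches μ E 1 x x :=
  ⟨0, (killedTransition_zero μ hx).ge⟩

theorem mono (h : Reaches μ E c x y) (hc : c' ≤ c) : Reaches μ E c' x y :=
  h.imp fun _ ht => hc.trans ht

theorem trans (h : Reaches μ E c x y) (h' : Reaches μ E c' y z) (hc' : 0 ≤ c') :
    Reaches μ E (c * c') x z := by
  obtain ⟨s, hs⟩ := h
  obtain ⟨t, ht⟩ := h'
  exact ⟨s + t, (mul_le_mul hs ht hc' (killedTransition_nonneg ..)).trans
    (killedTransition_mul_le μ E s t x y z)⟩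

theorem translate (h : Reaches μ F c x y) (ha : ∀ w ∈ F, a + w ∈ E) :
    Reaches μ E c (a + x) (a + y) :=
  h.imp fun t ht => ht.trans (killedTransition_le_translate μ ha t x y)

theorem add_free (h : Reaches μ Set.univ c 0 x) (h' : Reaches μ Set.univ c' 0 y) (hc' : 0 ≤ c') :
    Reaches μ Set.univ (c * c') 0 (x + y) := by
  have := h'.translate (a := x) (E := Set.univ) fun _ _ => Set.mem_univ _
  rw [add_zero] at this
  exact h.trans this hc'

theorem nsmul_free (h : Reaches μ Set.univ c 0 x) (hc : 0 ≤ c) (n : ℕ) :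
    Reaches μ Set.univ (c ^ n) 0 (n • x) := by
  induction n with
  | zero => simpa using refl (μ := μ) (Set.mem_univ (0 : IntLattice d))
  | succ n ih => rw [pow_succ, succ_nsmul]; exact ih.add_free h hc

theorem sum_free {ι : Type*} (s : Finset ι) {c : ι → ℝ} {x : ι → IntLattice d}
    (h : ∀ i ∈ s, Reaches μ Set.univ (c i) 0 (x i)) (hc : ∀ i ∈ s, 0 ≤ c i) :
    Reaches μ Set.univ (∏ i ∈ s, c i) 0 (∑ i ∈ s, x i) := by
  classical
  induction s using Finset.induction_on with
  | empty => simpa using refl (μ := μ) (Set.mem_univ (0 : IntLattice d))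
  | insert j s hj ih =>
    rw [Finset.prod_insert hj, Finset.sum_insert hj]
    exact (h j (Finset.mem_insert_self j s)).add_free
      (ih (fun i hi => h i (Finset.mem_insert_of_mem hi))
        fun i hi => hc i (Finset.mem_insert_of_mem hi))
      (Finset.prod_nonneg fun i hi => hc i (Finset.mem_insert_of_mem hi))

end Reaches

/-- The free walk reaches every unit vector with positive probability. -/
def ReachesUnitVectors (μ : Measure (IntLattice d)) [IsProbabilityMeasure μ] : Prop :=
  ∀ i : Fin d, (∃ c > 0, Reaches μ Set.univ c 0 (Pi.single i 1)) ∧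
    ∃ c > 0, Reaches μ Set.univ c 0 (Pi.single i (-1))

/-! ### Exponential cost of displacement for the free walk -/

section FreeWalk

variable {μ : Measure (IntLattice d)} [IsProbabilityMeasure μ]

/-- Move one coordinate at a time. This pays for rounding: a bounded lattice error costs only a
constant factor. -/
theorem ReachesUnitVectors.exists_pow_reaches (h : ReachesUnitVectors μ) :
    ∃ ρ : ℝ, 0 < ρ ∧ ρ ≤ 1 ∧
      ∀ x : IntLattice d, Reaches μ Set.univ (ρ ^ ∑ i, (x i).natAbs) 0 x := by
  choose h₁ h₂ using h
  choose c hc hr using h₁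
  choose c' hc' hr' using h₂
  have hlow : ∃ ρ : ℝ, 0 < ρ ∧ ρ ≤ 1 ∧ ∀ i, ρ ≤ c i ∧ ρ ≤ c' i := by
    have : ∀ᶠ ρ : ℝ in 𝓝[>] 0, ρ ≤ 1 ∧ ∀ i, ρ ≤ c i ∧ ρ ≤ c' i := by
      refine Filter.Eventually.and ?_ (Filter.eventually_all.2 fun i => .and ?_ ?_)
      · exact nhdsWithin_le_nhds (Iic_mem_nhds one_pos)
      · exact nhdsWithin_le_nhds (Iic_mem_nhds (hc i))
      · exact nhdsWithin_le_nhds (Iic_mem_nhds (hc' i))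
    obtain ⟨ρ, h, hρ⟩ := (this.and self_mem_nhdsWithin).exists
    exact ⟨ρ, hρ, h⟩
  obtain ⟨ρ, hρ, hρ1, hρc⟩ := hlow
  refine ⟨ρ, hρ, hρ1, fun x => ?_⟩
  have hx := Reaches.sum_free (μ := μ) Finset.univ (c := fun i => ρ ^ (x i).natAbs)
    (x := fun i => Pi.single i (x i)) (fun i _ => ?_) fun i _ => by positivity
  · rwa [Finset.univ_sum_single, Finset.prod_pow_eq_pow_sum] at hx
  · rcases Int.natAbs_eq (x i) with hi | hi
    · have := ((hr i).mono (hρc i).1).nsmul_free hρ.le (x i).natAbs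
      rwa [← Pi.single_smul, nsmul_one, ← hi] at this
    · have := ((hr' i).mono (hρc i).2).nsmul_free hρ.le (x i).natAbs
      rwa [← Pi.single_smul, nsmul_eq_mul, mul_neg_one, ← hi] at this

/-- The coordinatewise integer part. -/
noncomputable def latticeFloor (w : EuclideanSpace ℝ (Fin d)) : IntLattice d := fun i => ⌊w i⌋

/-- The directions in which the free walk moves at exponential cost at most one per unit length. -/
def unitCostSet (μ : Measure (IntLattice d)) [IsProbabilityMeasure μ] :
    Set (EuclideanSpace ℝ (Fin d)) :=
  {w | ∃ c > 0, ∀ s : ℝ, 0 ≤ s → Reaches μ Set.univ (c * Real.exp (-s)) 0 (latticeFloor (s • w))}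

/-- Travel `s * a` along `w`, then `s * b` along `w'`: costs add up to `s`. Rounding leaves an error
of 0 or 1 per coordinate, hence the factor `ρ ^ d`. -/
theorem ReachesUnitVectors.convex_unitCostSet (h : ReachesUnitVectors μ) :
    Convex ℝ (unitCostSet μ) := by
  obtain ⟨ρ, hρ, hρ1, hr⟩ := h.exists_pow_reaches
  rintro w ⟨c, hc, hw⟩ w' ⟨c', hc', hw'⟩ a b ha hb hab
  refine ⟨c * c' * ρ ^ d, by positivity, fun s hs => ?_⟩
  set rem : IntLattice d := latticeFloor (s • (a • w + b • w')) -
    (latticeFloor ((s * a) • w) + latticeFloor ((s * b) • w')) with hrem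
  have hl : ∑ i, (rem i).natAbs ≤ d := by
    calc ∑ i, (rem i).natAbs ≤ ∑ _i : Fin d, 1 := Finset.sum_le_sum fun i _ => ?_
      _ = d := by simp
    have e : s * (a * w i + b * w' i) = s * a * w i + s * b * w' i := by ring
    have h1 := Int.le_floor_add (s * a * w i) (s * b * w' i)
    have h2 := Int.le_floor_add_floor (s * a * w i) (s * b * w' i)
    simp only [hrem, latticeFloor, Pi.sub_apply, Pi.add_apply, PiLp.smul_apply, PiLp.add_apply,
      smul_eq_mul, e]
    omega
  have key := ((hw (s * a) (by positivity)).add_free (hw' (s * b) (by positivity))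
    (by positivity)).add_free (hr rem) (by positivity)
  rw [hrem, add_sub_cancel] at key
  refine key.mono ?_
  have e : Real.exp (-s) = Real.exp (-(s * a)) * Real.exp (-(s * b)) := by
    rw [← Real.exp_add, ← neg_add, ← mul_add, hab, mul_one]
  rw [e, ← hrem]
  calc _ = c * Real.exp (-(s * a)) * (c' * Real.exp (-(s * b))) * ρ ^ d := by ring
    _ ≤ _ := mul_le_mul_of_nonneg_left (pow_le_pow_of_le_one hρ.le hρ1 hl) (by positivity)

theorem ReachesUnitVectors.unitCostSet_mem_nhds_zero (h : ReachesUnitVectors μ) :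
    unitCostSet μ ∈ 𝓝 0 := by
  obtain ⟨ρ, hρ, hρ1, hr⟩ := h.exists_pow_reaches
  have hlog : 0 ≤ -Real.log ρ := neg_nonneg.2 (Real.log_nonpos hρ.le hρ1)
  set L := -Real.log ρ with hL
  -- At most `d * (s * (d * L + 1)⁻¹ + 1)` unit moves are needed, each of cost `L`: in total at most
  -- `s + d * L`.
  refine Metric.mem_nhds_iff.2 ⟨(d * L + 1)⁻¹, by positivity, fun w hw => ?_⟩
  refine ⟨Real.exp (-(d * L)), Real.exp_pos _, fun s hs => (hr _).mono ?_⟩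
  have hlen : ((∑ i, (latticeFloor (s • w) i).natAbs : ℕ) : ℝ) ≤ d * (s * (d * L + 1)⁻¹ + 1) := by
    push_cast
    calc ∑ i, ((latticeFloor (s • w) i).natAbs : ℝ) ≤
        ∑ _i : Fin d, (s * (d * L + 1)⁻¹ + 1) := Finset.sum_le_sum fun i _ => ?_
      _ = _ := by rw [Finset.sum_const, Finset.card_univ, Fintype.card_fin, nsmul_eq_mul]
    rw [mem_ball_zero_iff] at hw
    have h1 : |w i| ≤ (d * L + 1)⁻¹ := (PiLp.norm_apply_le w i).trans hw.le
    rw [Nat.cast_natAbs, Int.cast_abs]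
    have h2 : |s * w i| ≤ s * (d * L + 1)⁻¹ := by
      rw [abs_mul, abs_of_nonneg hs]
      exact mul_le_mul_of_nonneg_left h1 hs
    have h3 := abs_le.1 h2
    simp only [latticeFloor, PiLp.smul_apply, smul_eq_mul]
    have h4 := Int.floor_le (s * w i)
    have h5 := Int.lt_floor_add_one (s * w i)
    exact abs_le.2 ⟨by linarith, by linarith⟩
  rw [← Real.exp_add, ← Real.rpow_natCast, Real.rpow_def_of_pos hρ]
  refine Real.exp_le_exp.2 ?_
  have h6 : d * L * (d * L + 1)⁻¹ ≤ 1 := by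
    rw [← div_eq_mul_inv, div_le_one (by positivity)]; linarith
  have h7 : Real.log ρ = -L := by simp [hL]
  rw [h7]
  nlinarith [mul_le_mul_of_nonneg_left hlen hlog, mul_le_mul_of_nonneg_left h6 hs]

/-- Repeat the displacement `x` about `s / ψ` times; the remainder is bounded independently of `s`.
-/
theorem ReachesUnitVectors.inv_smul_mem_unitCostSet (h : ReachesUnitVectors μ) {ψ : ℝ}
    (hψ : 0 < ψ) {x : IntLattice d} (hx : Reaches μ Set.univ (Real.exp (-ψ)) 0 x) :
    ψ⁻¹ • latticeToEuclidean x ∈ unitCostSet μ := by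
  obtain ⟨ρ, hρ, hρ1, hr⟩ := h.exists_pow_reaches
  refine ⟨ρ ^ ∑ i, ((x i).natAbs + 1), by positivity, fun s hs => ?_⟩
  set m : ℕ := ⌊s / ψ⌋₊
  have hm : (m : ℝ) ≤ s / ψ := Nat.floor_le (by positivity)
  have hm' : s / ψ < m + 1 := Nat.lt_floor_add_one _
  set rem : IntLattice d :=
    latticeFloor (s • ψ⁻¹ • latticeToEuclidean x) - m • x with hrem
  have hl : ∑ i, (rem i).natAbs ≤ ∑ i, ((x i).natAbs + 1) := by
    refine Finset.sum_le_sum fun i _ => ?_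
    have h1 : |(s / ψ - m) * x i| ≤ |(x i : ℝ)| := by
      rw [abs_mul]
      refine mul_le_of_le_one_left (abs_nonneg _) ?_
      rw [abs_le]; constructor <;> linarith
    have h2 := abs_le.1 h1
    have h3 := Int.floor_le (s * (ψ⁻¹ * (x i : ℝ)))
    have h4 := Int.lt_floor_add_one (s * (ψ⁻¹ * (x i : ℝ)))
    have e : (s / ψ - m) * x i = s * (ψ⁻¹ * (x i : ℝ)) - m * x i := by
      field_simp
    rw [e] at h2
    have h5 : |(rem i : ℝ)| ≤ |(x i : ℝ)| + 1 := by
      have hri : rem i = ⌊s * (ψ⁻¹ * (x i : ℝ))⌋ - m * x i := by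
        rw [← nsmul_eq_mul]; rfl
      rw [hri]
      push_cast
      exact abs_le.2 ⟨by linarith, by linarith⟩
    have h6 : |rem i| ≤ |x i| + 1 := by exact_mod_cast h5
    rw [Int.abs_eq_natAbs, Int.abs_eq_natAbs] at h6
    exact_mod_cast h6
  have key := (hx.nsmul_free (Real.exp_pos _).le m).add_free (hr rem) (by positivity)
  rw [hrem, add_sub_cancel] at key
  refine key.mono ?_
  rw [← hrem, mul_comm]
  refine mul_le_mul ?_ (pow_le_pow_of_le_one hρ.le hρ1 hl) (by positivity) (by positivity)
  rw [← Real.exp_nat_mul]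
  refine Real.exp_le_exp.2 ?_
  rw [le_div_iff₀ hψ] at hm
  linarith

/-- Finitely many jumps keep the reachable points in a box growing linearly in time, and cover the
case `R(α) = ∞`. -/
theorem exists_one_lt_truncated_jumpGeneratingFunction {μ : Measure (IntLattice d)}
    [IsProbabilityMeasure μ] (hMin : HasStrictMinAtZero μ)
    {α : EuclideanSpace ℝ (Fin d)} (hα : α ≠ 0) :
    ∃ K : Finset (IntLattice d),
      1 < ∑ v ∈ K, μ.real {v} * Real.exp (inner ℝ α (latticeToEuclidean v)) := by
  have h := hMin.2 α hα
  rw [hMin.1, jumpGeneratingFunction, ENNReal.tsum_eq_iSup_sum, lt_iSup_iff] at h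
  obtain ⟨K, hK⟩ := h
  refine ⟨K, ?_⟩
  have hne : ∀ v ∈ K,
      μ {v} * ENNReal.ofReal (Real.exp (inner ℝ α (latticeToEuclidean v))) ≠ ⊤ :=
    fun v _ => ENNReal.mul_ne_top (measure_ne_top _ _) ENNReal.ofReal_ne_top
  have := (ENNReal.toReal_lt_toReal ENNReal.one_ne_top (ENNReal.sum_ne_top.2 hne)).2 hK
  rw [ENNReal.toReal_one, ENNReal.toReal_sum hne] at this
  refine this.trans_eq (Finset.sum_congr rfl fun v _ => ?_)
  rw [ENNReal.toReal_mul, ENNReal.toReal_ofReal (Real.exp_pos _).le, measureReal_def]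

theorem latticeToEuclidean_add (x y : IntLattice d) :
    latticeToEuclidean (x + y) = latticeToEuclidean x + latticeToEuclidean y := by
  ext i; simp [latticeToEuclidean]

/-- If the jump generating function exceeds one at `α`, the weights `exp ⟨α, x⟩` outgrow the
transition probabilities of the free walk. -/
theorem exists_one_lt_killedTransition_mul_exp (hMin : HasStrictMinAtZero μ)
    {α : EuclideanSpace ℝ (Fin d)} (hα : α ≠ 0) :
    ∃ (t : ℕ) (x : IntLattice d), 1 < killedTransition μ Set.univ t 0 x *
      Real.exp (inner ℝ α (latticeToEuclidean x)) := by
  obtain ⟨K, hK⟩ := exists_one_lt_truncated_jumpGeneratingFunction hMin hα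
  set R := ∑ v ∈ K, μ.real {v} * Real.exp (inner ℝ α (latticeToEuclidean v)) with hR
  by_contra! hle
  obtain ⟨r, hr⟩ : ∃ r : ℕ, ∀ v ∈ K, ∀ i, |v i| ≤ r := by
    refine ⟨∑ v ∈ K, ∑ i, (v i).natAbs, fun v hv i => ?_⟩
    rw [Int.abs_eq_natAbs]
    norm_cast
    exact (Finset.single_le_sum (f := fun i => (v i).natAbs)
      (fun _ _ => Nat.zero_le _) (Finset.mem_univ i)).trans
      (Finset.single_le_sum (f := fun v : IntLattice d => ∑ i, (v i).natAbs)
        (fun _ _ => Nat.zero_le _) hv)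
  let box : ℕ → Finset (IntLattice d) := fun t =>
    Finset.Icc (fun _ => -((r * t : ℕ) : ℤ)) (fun _ => ((r * t : ℕ) : ℤ))
  let f : ℕ → IntLattice d → ℝ := fun t x =>
    killedTransition μ Set.univ t 0 x * Real.exp (inner ℝ α (latticeToEuclidean x))
  have hf0 : ∀ t x, 0 ≤ f t x := fun t x =>
    mul_nonneg (killedTransition_nonneg ..) (Real.exp_pos _).le
  -- Decompose according to the last jump `v`; the exponential weight is multiplicative.
  have hstep : ∀ t x, ∑ v ∈ K,
      μ.real {v} * Real.exp (inner ℝ α (latticeToEuclidean v)) * f t (x - v) ≤ f (t + 1) x := by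
    intro t x
    have h1 := sum_killedTransition_mul_le μ Set.univ t 1 0 x
      (K.map (Equiv.subLeft x).toEmbedding)
    rw [Finset.sum_map] at h1
    refine le_trans (le_of_eq ?_) (mul_le_mul_of_nonneg_right h1 (Real.exp_pos _).le)
    rw [Finset.sum_mul]
    refine Finset.sum_congr rfl fun v _ => ?_
    have e : latticeToEuclidean x = latticeToEuclidean v + latticeToEuclidean (x - v) := by
      rw [← latticeToEuclidean_add, add_sub_cancel]
    rw [killedTransition_one μ (Set.mem_univ _) (Set.mem_univ _)]
    simp only [f, Equiv.coe_toEmbedding, Equiv.subLeft_apply, sub_sub_cancel]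
    rw [e, inner_add_right, Real.exp_add]
    ring
  have hgrow : ∀ t, R ^ t ≤ ∑ x ∈ box t, f t x := by
    intro t
    induction t with
    | zero =>
      refine le_trans (le_of_eq ?_) (Finset.single_le_sum (fun x _ => hf0 0 x)
        (show (0 : IntLattice d) ∈ box 0 by simp only [box, mul_zero, Nat.cast_zero, neg_zero]; exact Finset.mem_Icc.2 ⟨le_rfl, le_rfl⟩))
      have : latticeToEuclidean (0 : IntLattice d) = 0 := by ext i; simp [latticeToEuclidean]
      simp [f, killedTransition_zero μ (Set.mem_univ (0 : IntLattice d)), this]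
    | succ t ih =>
      calc R ^ (t + 1) = R * R ^ t := pow_succ' R t
        _ ≤ R * ∑ x ∈ box t, f t x := mul_le_mul_of_nonneg_left ih (by linarith)
        _ = ∑ v ∈ K, μ.real {v} * Real.exp (inner ℝ α (latticeToEuclidean v)) *
              ∑ x ∈ box t, f t x := by rw [hR, Finset.sum_mul]
        _ ≤ ∑ v ∈ K, μ.real {v} * Real.exp (inner ℝ α (latticeToEuclidean v)) *
              ∑ x ∈ box (t + 1), f t (x - v) := by
            refine Finset.sum_le_sum fun v hv => mul_le_mul_of_nonneg_left ?_ (by positivity)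
            have e : ∑ x ∈ box t, f t x =
                ∑ x ∈ (box t).map (Equiv.addRight v).toEmbedding, f t (x - v) := by
              simp [Finset.sum_map]
            rw [e]
            refine Finset.sum_le_sum_of_subset_of_nonneg ?_ fun x _ _ => hf0 t _
            intro x hx
            obtain ⟨y, hy, rfl⟩ := Finset.mem_map.1 hx
            simp only [box, Finset.mem_Icc, Pi.le_def] at hy ⊢
            refine ⟨fun i => ?_, fun i => ?_⟩
            · have h1 := hy.1 i
              have h2 := (abs_le.1 (hr v hv i)).1
              simp only [Equiv.coe_toEmbedding, Equiv.coe_addRight, Pi.add_apply]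
              push_cast at h1 ⊢
              linarith
            · have h1 := hy.2 i
              have h2 := (abs_le.1 (hr v hv i)).2
              simp only [Equiv.coe_toEmbedding, Equiv.coe_addRight, Pi.add_apply]
              push_cast at h1 ⊢
              linarith
        _ = ∑ x ∈ box (t + 1), ∑ v ∈ K,
              μ.real {v} * Real.exp (inner ℝ α (latticeToEuclidean v)) * f t (x - v) := by
            simp only [Finset.mul_sum]
            exact Finset.sum_comm
        _ ≤ ∑ x ∈ box (t + 1), f (t + 1) x := Finset.sum_le_sum fun x _ => hstep t x
  have hcard : ∀ t, ((box t).card : ℝ) = (2 * (r * t) + 1) ^ d := by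
    intro t
    have : (box t).card = (2 * (r * t) + 1) ^ d := by
      simp only [box, Pi.card_Icc, Int.card_Icc, Finset.prod_const, Finset.card_univ,
        Fintype.card_fin]
      congr 1
      generalize r * t = q
      omega
    rw [this]; push_cast; rfl
  -- If all weights were at most 1, their sum would be at most the number of points of the box,
  -- polynomial in `t`.
  have hbound : ∀ t : ℕ, 1 ≤ t → R ^ t ≤ (2 * r + 1) ^ d * (t : ℝ) ^ d := by
    intro t ht
    have ht' : (1 : ℝ) ≤ t := by exact_mod_cast ht
    calc R ^ t ≤ ∑ x ∈ box t, f t x := hgrow t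
      _ ≤ ∑ _x ∈ box t, (1 : ℝ) := Finset.sum_le_sum fun x _ => hle t x
      _ = (2 * (r * t) + 1) ^ d := by rw [Finset.sum_const, nsmul_one, hcard]
      _ ≤ ((2 * r + 1) * t) ^ d := pow_le_pow_left₀ (by positivity) (by nlinarith) d
      _ = _ := mul_pow ..
  have hlim := (tendsto_pow_const_div_const_pow_of_one_lt d hK).const_mul ((2 * (r : ℝ) + 1) ^ d)
  rw [mul_zero] at hlim
  obtain ⟨t, ht, ht1⟩ := ((hlim.eventually (gt_mem_nhds one_pos)).and (eventually_ge_atTop 1)).exists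
  rw [← mul_div_assoc, div_lt_one (by positivity)] at ht
  exact absurd (hbound t ht1) (not_le.2 ht)

theorem ReachesUnitVectors.unitCostSet_eq_univ (h : ReachesUnitVectors μ)
    (hMin : HasStrictMinAtZero μ) : unitCostSet μ = Set.univ := by
  refine Set.eq_univ_of_forall fun w => interior_subset ?_
  by_contra hw
  have hconv := h.convex_unitCostSet
  have h0 : (0 : EuclideanSpace ℝ (Fin d)) ∈ interior (unitCostSet μ) :=
    mem_interior_iff_mem_nhds.2 h.unitCostSet_mem_nhds_zero
  obtain ⟨f, hf⟩ := geometric_hahn_banach_open_point hconv.interior isOpen_interior hw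
  have hfw : 0 < f w := by simpa using hf 0 h0
  -- Separation only concerns the interior, but a convex set with nonempty interior lies in the
  -- closure of its interior.
  have hle : ∀ b ∈ unitCostSet μ, f b ≤ f w := by
    intro b hb
    have hcl : b ∈ closure (interior (unitCostSet μ)) := by
      rw [hconv.closure_interior_eq_closure_of_nonempty_interior ⟨0, h0⟩]
      exact subset_closure hb
    exact closure_minimal (t := {b | f b ≤ f w}) (fun b hb => (hf b hb).le)
      (isClosed_le f.continuous continuous_const) hcl
  -- Normalised so that `⟨α, w⟩ = 1`, hence `⟨α, ·⟩ ≤ 1` on `unitCostSet μ`.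
  set α : EuclideanSpace ℝ (Fin d) :=
    (InnerProductSpace.toDual ℝ (EuclideanSpace ℝ (Fin d))).symm ((f w)⁻¹ • f) with hαdef
  have hαf : ∀ v, inner ℝ α v = (f w)⁻¹ * f v := fun v => by
    rw [hαdef, InnerProductSpace.toDual_symm_apply]; rfl
  have hα : α ≠ 0 := by
    intro h
    have := hαf w
    rw [h, inner_zero_left, inv_mul_cancel₀ hfw.ne'] at this
    exact zero_ne_one this
  obtain ⟨t, x, hx⟩ := exists_one_lt_killedTransition_mul_exp (μ := μ) hMin hα
  set p := killedTransition μ Set.univ t 0 x with hp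
  have hp0 : 0 < p := by
    by_contra! hneg
    have := mul_nonpos_of_nonpos_of_nonneg hneg
      (Real.exp_pos (inner ℝ α (latticeToEuclidean x))).le
    linarith
  have hp1 : p ≤ 1 := measureReal_le_one
  have hlog : 0 ≤ -Real.log p := neg_nonneg.2 (Real.log_nonpos hp0.le hp1)
  have hlt : -Real.log p < inner ℝ α (latticeToEuclidean x) := by
    have := Real.log_pos hx
    rw [Real.log_mul hp0.ne' (Real.exp_pos _).ne', Real.log_exp] at this
    linarith
  -- A strict upper bound for the cost stays positive even if `p = 1`; then `x / ψ` lies in the set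
  -- although `⟨α, x / ψ⟩ > 1`.
  obtain ⟨ψ, hψ, hψ'⟩ := exists_between hlt
  have hψ0 : 0 < ψ := hlog.trans_lt hψ
  have hreach : Reaches μ Set.univ (Real.exp (-ψ)) 0 x :=
    ⟨t, by rw [← hp, ← Real.le_log_iff_exp_le hp0]; linarith⟩
  have := hle _ (h.inv_smul_mem_unitCostSet hψ0 hreach)
  rw [map_smul, smul_eq_mul, inv_mul_le_iff₀ hψ0] at this
  rw [hαf, ← div_eq_inv_mul, lt_div_iff₀ hfw] at hψ'
  linarith

/-- The free walk moves in every lattice direction at subexponential cost. -/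
theorem ReachesUnitVectors.exists_reaches_nsmul (h : ReachesUnitVectors μ)
    (hMin : HasStrictMinAtZero μ) (u : IntLattice d) {ε : ℝ} (hε : 0 < ε) :
    ∃ c > 0, ∀ n : ℕ, Reaches μ Set.univ (c * Real.exp (-(ε * n))) 0 (n • u) := by
  -- At `s = ε * n` this direction gives exactly `n • u`, so the floor has no effect.
  have hmem : ε⁻¹ • latticeToEuclidean u ∈ unitCostSet μ := by
    rw [h.unitCostSet_eq_univ hMin]; exact Set.mem_univ _
  obtain ⟨c, hc, hr⟩ := hmem
  refine ⟨c, hc, fun n => ?_⟩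
  have := hr (ε * n) (by positivity)
  convert this using 1
  ext i
  have e : ε * n * (ε⁻¹ * (u i : ℝ)) = ((n * u i : ℤ) : ℝ) := by
    push_cast
    field_simp
  simp only [latticeFloor, latticeToEuclidean, PiLp.smul_apply, smul_eq_mul, e, Int.floor_intCast,
    Pi.smul_apply, nsmul_eq_mul]

end FreeWalk

/-! ### Geometry of the lattice cone -/

section Cone

variable {E : Set (IntLattice d)}

theorem IsLatticeCone.add_mem (hE : IsLatticeCone E) {x y : IntLattice d} (hx : x ∈ E)
    (hy : y ∈ E) : x + y ∈ E := by
  obtain ⟨C, _, rfl⟩ := hE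
  have := C.closure.add_mem (x := latticeToEuclidean x) (y := latticeToEuclidean y)
    (by simpa using hx) (by simpa using hy)
  rw [← latticeToEuclidean_add] at this
  simpa using this

theorem IsLatticeCone.zero_mem (hE : IsLatticeCone E) (hne : E.Nonempty) :
    (0 : IntLattice d) ∈ E := by
  obtain ⟨C, _, rfl⟩ := hE
  obtain ⟨u, hu⟩ := hne
  obtain ⟨c, hc⟩ : (C : Set (EuclideanSpace ℝ (Fin d))).Nonempty :=
    closure_nonempty_iff.1 ⟨_, hu⟩
  have h0 : latticeToEuclidean (0 : IntLattice d) = 0 := by ext i; simp [latticeToEuclidean]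
  change latticeToEuclidean (0 : IntLattice d) ∈ closure (C : Set (EuclideanSpace ℝ (Fin d)))
  rw [h0]
  have hlim : Tendsto (fun s : ℝ => s • c) (𝓝[>] 0) (𝓝 ((0 : ℝ) • c)) :=
    ((continuous_id.smul continuous_const).tendsto 0).mono_left nhdsWithin_le_nhds
  rw [zero_smul] at hlim
  exact mem_closure_of_tendsto hlim
    (eventually_nhdsWithin_of_forall fun s hs => C.smul_mem hs hc)

theorem IsLatticeCone.nsmul_mem (hE : IsLatticeCone E) {x : IntLattice d} (hx : x ∈ E) (n : ℕ) :
    n • x ∈ E := by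
  induction n with
  | zero => rw [zero_smul]; exact hE.zero_mem ⟨x, hx⟩
  | succ n ih => rw [succ_nsmul]; exact hE.add_mem ih hx

/-- An open cone contains a ball around some `c`; scaling by `N` makes its radius exceed `r + 1`,
where `r` is for the box and 1 for rounding `N • c`. -/
theorem IsLatticeCone.exists_box_subset (hE : IsLatticeCone E) (hne : E.Nonempty) (r : ℕ) :
    ∃ z : IntLattice d, ∀ w : IntLattice d, (∀ i, |w i| ≤ r) → z + w ∈ E := by
  obtain ⟨C, hC, rfl⟩ := hE
  obtain ⟨u, hu⟩ := hne
  obtain ⟨c, hc⟩ : (C : Set (EuclideanSpace ℝ (Fin d))).Nonempty :=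
    closure_nonempty_iff.1 ⟨_, hu⟩
  have hopen : IsOpen {v : Fin d → ℝ | WithLp.toLp 2 v ∈ C} :=
    hC.preimage (PiLp.continuous_toLp 2 _)
  obtain ⟨δ, hδ, hball⟩ := Metric.isOpen_iff.1 hopen c.ofLp hc
  obtain ⟨N, hN⟩ := exists_nat_gt ((r + 1) / δ)
  have hN0 : (0 : ℝ) < N := lt_of_le_of_lt (by positivity) hN
  refine ⟨latticeFloor ((N : ℝ) • c), fun w hw => subset_closure ?_⟩
  set z := latticeFloor ((N : ℝ) • c) with hz
  have hmem : (fun i => (N : ℝ)⁻¹ * ((z + w) i : ℝ)) ∈ Metric.ball c.ofLp δ := by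
    rw [mem_ball_iff_norm, pi_norm_lt_iff hδ]
    intro i
    have h1 := Int.floor_le ((N : ℝ) * c i)
    have h2 := Int.lt_floor_add_one ((N : ℝ) * c i)
    have hzi : z i = ⌊(N : ℝ) * c i⌋ := rfl
    have h3 : |(w i : ℝ)| ≤ r := by exact_mod_cast hw i
    have h4 := abs_le.1 h3
    have e : (N : ℝ)⁻¹ * ((z + w) i : ℝ) - c i = (N : ℝ)⁻¹ * ((z i + w i : ℝ) - N * c i) := by
      rw [Pi.add_apply]
      push_cast
      field_simp
    rw [Pi.sub_apply, e, Real.norm_eq_abs, abs_mul, abs_of_pos (inv_pos.2 hN0), hzi,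
      inv_mul_lt_iff₀ hN0]
    rw [div_lt_iff₀ hδ] at hN
    refine lt_of_le_of_lt (abs_le.2 ⟨?_, ?_⟩) hN <;> linarith
  have hsmul := C.smul_mem hN0 (hball hmem)
  have e : latticeToEuclidean (z + w) =
      (N : ℝ) • WithLp.toLp 2 fun i => (N : ℝ)⁻¹ * ((z + w) i : ℝ) := by
    ext i
    simp only [latticeToEuclidean, PiLp.smul_apply, smul_eq_mul]
    rw [mul_inv_cancel_left₀ hN0.ne']
  rw [e]
  exact hsmul

end Cone

/-! ### Consequences of the communication condition -/

section Communication

variable {μ : Measure (IntLattice d)} [IsProbabilityMeasure μ] {E : Set (IntLattice d)}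

theorem Communicates.exists_killedTransition_pos_of_ne (hE : Communicates μ E)
    {x y : IntLattice d} (hx : x ∈ E) (hy : y ∈ E) (hxy : x ≠ y) :
    ∃ t > 0, 0 < killedTransition μ E t x y := by
  obtain ⟨κ, E₀, -, hpos, hpath⟩ := hE
  obtain ⟨n, p, rfl, rfl, -, hp, hstep⟩ := hpath x hx y hy hxy
  have hn : n ≠ 0 := by rintro rfl; exact hxy rfl
  have key : ∀ j ≤ n, 0 < killedTransition μ E j (p 0) (p j) := by
    intro j
    induction j with
    | zero => intro _; rw [killedTransition_zero μ hx]; exact one_pos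
    | succ j ih =>
      intro hj
      refine lt_of_lt_of_le (mul_pos (ih (by omega)) ?_) (killedTransition_mul_le μ E j 1 _ (p j) _)
      rw [killedTransition_one μ (hp j (by omega)) (hp _ hj)]
      exact ENNReal.toReal_pos (hpos _ (hstep j (by omega))).ne' (measure_ne_top _ _)
  exact ⟨n, Nat.pos_of_ne_zero hn, key n le_rfl⟩

theorem IsLatticeCone.mem_and_add_single_mem (hC : IsLatticeCone E) (hne : E.Nonempty) :
    ∃ z ∈ E, ∀ i : Fin d, z + Pi.single i 1 ∈ E ∧ z + Pi.single i (-1) ∈ E := by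
  obtain ⟨z, hz⟩ := hC.exists_box_subset hne 1
  refine ⟨z, by simpa using hz 0 (by simp), fun i => ⟨hz _ fun j => ?_, hz _ fun j => ?_⟩⟩ <;>
  · rcases eq_or_ne j i with rfl | h
    · simp
    · simp [h]

/-- For `x = y` go to another point and back. If there is none, the box in `E` forces `d = 0`, where
every jump is null. -/
theorem Communicates.exists_killedTransition_pos (hE : Communicates μ E) (hC : IsLatticeCone E)
    {x y : IntLattice d} (hx : x ∈ E) (hy : y ∈ E) : ∃ t > 0, 0 < killedTransition μ E t x y := by
  by_cases hxy : x ≠ y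
  · exact hE.exists_killedTransition_pos_of_ne hx hy hxy
  obtain rfl := not_not.1 hxy
  by_cases hother : ∃ z ∈ E, x ≠ z
  · obtain ⟨z, hz, hne⟩ := hother
    obtain ⟨s, hs, hs'⟩ := hE.exists_killedTransition_pos_of_ne hx hz hne
    obtain ⟨t, _, ht'⟩ := hE.exists_killedTransition_pos_of_ne hz hx hne.symm
    exact ⟨s + t, by omega, (mul_pos hs' ht').trans_le (killedTransition_mul_le μ E s t x z x)⟩
  push Not at hother
  obtain ⟨z, hz, hz'⟩ := hC.mem_and_add_single_mem ⟨x, hx⟩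
  have hd : IsEmpty (Fin d) := by
    refine ⟨fun i => ?_⟩
    have h := congrFun ((hother z hz).symm.trans (hother _ (hz' i).1)) i
    simp at h
  refine ⟨1, one_pos, ?_⟩
  have huniv : ({x - x} : Set (IntLattice d)) = Set.univ :=
    Set.eq_univ_of_forall fun w => Subsingleton.elim _ _
  rw [killedTransition_one μ hx hx, huniv, probReal_univ]
  exact one_pos

theorem Communicates.exists_reaches (hE : Communicates μ E) (hC : IsLatticeCone E)
    {x y : IntLattice d} (hx : x ∈ E) (hy : y ∈ E) : ∃ c > 0, Reaches μ E c x y := by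
  obtain ⟨t, -, ht⟩ := hE.exists_killedTransition_pos hC hx hy
  exact ⟨_, ht, t, le_rfl⟩

theorem Communicates.reachesUnitVectors (hE : Communicates μ E) (hC : IsLatticeCone E)
    (hne : E.Nonempty) : ReachesUnitVectors μ := by
  obtain ⟨z, hz, hz'⟩ := hC.mem_and_add_single_mem hne
  have key : ∀ e, z + e ∈ E → ∃ c > 0, Reaches μ Set.univ c 0 e := by
    intro e he
    obtain ⟨c, hc, hr⟩ := hE.exists_reaches hC hz he
    refine ⟨c, hc, ?_⟩
    simpa using hr.translate (a := -z) (E := Set.univ) fun _ _ => Set.mem_univ _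
  exact fun i => ⟨key _ (hz' i).1, key _ (hz' i).2⟩

end Communication

/-! ### Subexponential lower bounds inside the cone -/

section Rate

variable {μ : Measure (IntLattice d)} [IsProbabilityMeasure μ] {E : Set (IntLattice d)}

/-- The free walk travels some multiple of `v` at a small exponential cost within a bounded
region. -/
theorem ReachesUnitVectors.exists_reaches_box (h : ReachesUnitVectors μ)
    (hMin : HasStrictMinAtZero μ) (v : IntLattice d) {ε : ℝ} (hε : 0 < ε) :
    ∃ k > 0, ∃ r : ℕ, Reaches μ {w | ∀ i, |w i| ≤ r} (Real.exp (-(ε * (k : ℕ)))) 0 (k • v) := by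
  obtain ⟨c, hc, hr⟩ := h.exists_reaches_nsmul hMin v (half_pos hε)
  -- Half of the rate absorbs the constant `c`; the inequality obtained is strict, leaving room to
  -- confine the path.
  obtain ⟨k, hk⟩ := exists_nat_gt (max 0 (-Real.log c / (ε / 2)))
  have hk0 : (0 : ℝ) < k := (le_max_left _ _).trans_lt hk
  have hk1 := (le_max_right _ _).trans_lt hk
  rw [div_lt_iff₀ (half_pos hε)] at hk1
  obtain ⟨t, ht⟩ := hr k
  have hlt : Real.exp (-(ε * k)) < killedTransition μ Set.univ t 0 (k • v) := by
    refine lt_of_lt_of_le ?_ ht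
    nth_rewrite 1 [← Real.exp_log hc]
    rw [← Real.exp_add, Real.exp_lt_exp]
    linarith
  obtain ⟨r, hr⟩ := exists_lt_killedTransition_box μ hlt
  exact ⟨k, by exact_mod_cast hk0, r, t, hr.le⟩

theorem exists_pos_forall_lt {P : ℕ → ℝ → Prop} (hP : ∀ j, ∃ c > 0, P j c)
    (hmono : ∀ j c c', P j c → c' ≤ c → P j c') (k : ℕ) : ∃ c > 0, ∀ j < k, P j c := by
  induction k with
  | zero => exact ⟨1, one_pos, by simp⟩
  | succ k ih =>
    obtain ⟨c, hc, h⟩ := ih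
    obtain ⟨c', hc', h'⟩ := hP k
    refine ⟨min c c', lt_min hc hc', fun j hj => ?_⟩
    rcases Nat.lt_succ_iff_lt_or_eq.1 hj with hj | rfl
    · exact hmono _ _ _ (h j hj) (min_le_left _ _)
    · exact hmono _ _ _ h' (min_le_right _ _)

variable {u : IntLattice d}

/-- The route is 0, `z`, `q • u + z`, `q • u`, `n • u`, where `q = k * (n / k)`. Only the second leg
depends on `n` in cost: the others are translates of finitely many paths. -/
theorem exists_reaches_nsmul_of_isLatticeCone (hComm : Communicates μ E) (hCone : IsLatticeCone E)
    (hMin : HasStrictMinAtZero μ) (hu : u ∈ E) {ε : ℝ} (hε : 0 < ε) :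
    ∃ c > 0, ∀ n : ℕ, Reaches μ E (c * Real.exp (-(ε * n))) 0 (n • u) := by
  have h0 := hCone.zero_mem ⟨u, hu⟩
  obtain ⟨k, hk, r, hr⟩ := (hComm.reachesUnitVectors hCone ⟨u, hu⟩).exists_reaches_box hMin u hε
  obtain ⟨z, hz⟩ := hCone.exists_box_subset ⟨u, hu⟩ r
  have hzE : z ∈ E := by simpa using hz 0 (by simp)
  have htrans : ∀ n : ℕ, ∀ w ∈ E, n • u + w ∈ E := fun n w hw =>
    hCone.add_mem (hCone.nsmul_mem hu n) hw
  have hmain : ∀ m : ℕ, Reaches μ E (Real.exp (-(ε * (k * m : ℕ)))) z ((k * m) • u + z) := by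
    intro m
    induction m with
    | zero => simpa using Reaches.refl (μ := μ) hzE
    | succ m ih =>
      have hstep := hr.translate (a := (k * m) • u + z) (E := E) fun w hw => by
        rw [add_assoc]; exact htrans _ _ (hz w hw)
      rw [add_zero, add_right_comm, ← add_smul] at hstep
      refine (ih.trans hstep (Real.exp_pos _).le).mono (le_of_eq ?_)
      rw [← Real.exp_add]
      push_cast
      ring_nf
  obtain ⟨a, ha, hra⟩ := hComm.exists_reaches hCone h0 hzE
  obtain ⟨b, hb, hrb⟩ := hComm.exists_reaches hCone hzE h0
  obtain ⟨g, hg, hrg⟩ := exists_pos_forall_lt (P := fun j c => Reaches μ E c 0 (j • u))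
    (fun j => hComm.exists_reaches hCone h0 (hCone.nsmul_mem hu j)) (fun _ _ _ h => h.mono) k
  refine ⟨a * b * g, by positivity, fun n => ?_⟩
  have h1 := hrb.translate (htrans (k * (n / k)))
  have h2 := (hrg (n % k) (Nat.mod_lt n hk)).translate (htrans (k * (n / k)))
  rw [← add_smul, Nat.div_add_mod] at h2
  refine (((hra.trans (hmain (n / k)) (Real.exp_pos _).le).trans h1 hb.le).trans h2 hg.le).mono ?_
  have hexp : Real.exp (-(ε * n)) ≤ Real.exp (-(ε * (k * (n / k) : ℕ))) := by
    refine Real.exp_le_exp.2 (neg_le_neg (mul_le_mul_of_nonneg_left ?_ hε.le))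
    exact_mod_cast Nat.mul_div_le n k
  calc _ = a * Real.exp (-(ε * n)) * b * g := by ring
    _ ≤ _ := by gcongr

theorem exists_reaches_zero_of_isLatticeCone (hComm : Communicates μ E) (hCone : IsLatticeCone E)
    (hMin : HasStrictMinAtZero μ) (hu : u ∈ E) {ε : ℝ} (hε : 0 < ε) :
    ∃ c > 0, ∀ n : ℕ, Reaches μ E (c * Real.exp (-(ε * n))) (n • u) 0 := by
  have h0 := hCone.zero_mem ⟨u, hu⟩
  obtain ⟨k, hk, r, hr⟩ := (hComm.reachesUnitVectors hCone ⟨u, hu⟩).exists_reaches_box hMin (-u) hε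
  obtain ⟨z, hz⟩ := hCone.exists_box_subset ⟨u, hu⟩ r
  have hzE : z ∈ E := by simpa using hz 0 (by simp)
  have htrans : ∀ n : ℕ, ∀ w ∈ E, n • u + w ∈ E := fun n w hw =>
    hCone.add_mem (hCone.nsmul_mem hu n) hw
  have hmain : ∀ m : ℕ, Reaches μ E (Real.exp (-(ε * (k * m : ℕ)))) ((k * m) • u + z) z := by
    intro m
    induction m with
    | zero => simpa using Reaches.refl (μ := μ) hzE
    | succ m ih =>
      -- Although `-u` may lie outside `E`, the box around the starting point lies in `E`, so the
      -- backward path does too.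
      have hstep := hr.translate (a := (k * (m + 1)) • u + z) (E := E) fun w hw => by
        rw [add_assoc]; exact htrans _ _ (hz w hw)
      have e : (k * (m + 1)) • u + z + k • -u = (k * m) • u + z := by
        rw [mul_add, mul_one, add_smul, smul_neg]; abel
      rw [add_zero, e] at hstep
      refine (hstep.trans ih (Real.exp_pos _).le).mono (le_of_eq ?_)
      rw [← Real.exp_add]
      push_cast
      ring_nf
  obtain ⟨a, ha, hra⟩ := hComm.exists_reaches hCone h0 hzE
  obtain ⟨b, hb, hrb⟩ := hComm.exists_reaches hCone hzE h0
  obtain ⟨g, hg, hrg⟩ := exists_pos_forall_lt (P := fun j c => Reaches μ E c (j • u) 0)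
    (fun j => hComm.exists_reaches hCone (hCone.nsmul_mem hu j) h0) (fun _ _ _ h => h.mono) k
  refine ⟨g * a * b, by positivity, fun n => ?_⟩
  have h1 := (hrg (n % k) (Nat.mod_lt n hk)).translate (htrans (k * (n / k)))
  rw [← add_smul, Nat.div_add_mod] at h1
  have h2 := hra.translate (htrans (k * (n / k)))
  refine (((h1.trans h2 ha.le).trans (hmain (n / k)) (Real.exp_pos _).le).trans hrb hb.le).mono ?_
  have hexp : Real.exp (-(ε * n)) ≤ Real.exp (-(ε * (k * (n / k) : ℕ))) := by
    refine Real.exp_le_exp.2 (neg_le_neg (mul_le_mul_of_nonneg_left ?_ hε.le))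
    exact_mod_cast Nat.mul_div_le n k
  calc _ = g * a * Real.exp (-(ε * n)) * b := by ring
    _ ≤ _ := by gcongr

/-- `Reaches` allows time 0 but hitting does not; the prefix of length `s > 0` makes the time
positive. -/
theorem Reaches.le_hittingProb {c p : ℝ} {x y z : IntLattice d} {s : ℕ} (h : Reaches μ E c y z)
    (hs : 0 < s) (hp : p ≤ killedTransition μ E s x y) (hc : 0 ≤ c) :
    p * c ≤ hittingProb μ E x z := by
  obtain ⟨t, ht⟩ := h
  calc p * c ≤ killedTransition μ E s x y * killedTransition μ E t y z :=
        mul_le_mul hp ht hc (killedTransition_nonneg ..)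
    _ ≤ killedTransition μ E (s + t) x z := killedTransition_mul_le μ E s t x y z
    _ ≤ hittingProb μ E x z := killedTransition_le_hittingProb μ E (by omega) x z

end Rate

/-! ### From exponential bounds to the uniform limits -/

theorem tendstoUniformlyOn_log_div_of_exp_le {α : Type*} {S : Set α} {q : ℕ → α → ℝ}
    (hq : ∀ n, ∀ x ∈ S, q n x ≤ 1)
    (hlow : ∀ ε > 0, ∃ c > 0, ∀ n : ℕ, ∀ x ∈ S, c * Real.exp (-(ε * n)) ≤ q n x) :
    TendstoUniformlyOn (fun (n : ℕ) x => (1 / (n : ℝ)) * Real.log (q n x)) (fun _ => 0) atTop S := by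
  rw [Metric.tendstoUniformlyOn_iff]
  intro ε hε
  -- The other half of `ε` dominates `-log c / n` for large `n`.
  obtain ⟨c, hc, h⟩ := hlow (ε / 2) (half_pos hε)
  obtain ⟨N, hN⟩ := exists_nat_gt (max 0 (-Real.log c / (ε / 2)))
  filter_upwards [eventually_ge_atTop N] with n hn x hx
  have hnN : (N : ℝ) ≤ n := by exact_mod_cast hn
  have hn0 : (0 : ℝ) < n := ((le_max_left _ _).trans_lt hN).trans_le hnN
  have hn1 := ((le_max_right _ _).trans_lt hN).trans_le hnN
  rw [div_lt_iff₀ (half_pos hε)] at hn1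
  have hpos : 0 < c * Real.exp (-(ε / 2 * n)) := by positivity
  have hlog := Real.log_le_log hpos (h n x hx)
  rw [Real.log_mul hc.ne' (Real.exp_pos _).ne', Real.log_exp] at hlog
  have hlog' := Real.log_nonpos (hpos.le.trans (h n x hx)) (hq n x hx)
  rw [dist_comm, Real.dist_0_eq_abs, abs_of_nonpos
    (mul_nonpos_of_nonneg_of_nonpos (by positivity) hlog'), one_div, ← mul_neg,
    inv_mul_lt_iff₀ hn0]
  linarith

theorem mainTheorem5 (d : ℕ) (μ : Measure (IntLattice d)) [IsProbabilityMeasure μ]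
    (E : Set (IntLattice d))
    (hTransient : IsTransientOn μ E) (hComm : Communicates μ E)
    (hCone : IsLatticeCone E) (hMin : HasStrictMinAtZero μ)
    (u : IntLattice d) (hu : u ∈ E) :
    (∀ x ∈ E, ∀ n : ℕ, 1 ≤ n →
      0 < hittingProb μ E x (x + n • u) ∧ 0 < hittingProb μ E (x + n • u) x) ∧
    TendstoUniformlyOn
      (fun (n : ℕ) (x : IntLattice d) => (1 / (n : ℝ)) * Real.log (hittingProb μ E x (x + n • u)))
      (fun _ => 0) atTop E ∧
    TendstoUniformlyOn
      (fun (n : ℕ) (x : IntLattice d) => (1 / (n : ℝ)) * Real.log (hittingProb μ E (x + n • u) x))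
      (fun _ => 0) atTop E := by
  have h0 := hCone.zero_mem ⟨u, hu⟩
  obtain ⟨s, hs, hpos⟩ := hComm.exists_killedTransition_pos hCone h0 h0
  set p := killedTransition μ E s 0 0 with hp
  have htrans : ∀ x ∈ E, ∀ w ∈ E, x + w ∈ E := fun x hx w hw => hCone.add_mem hx hw
  -- Translating a loop at 0 gives a return probability bounded below uniformly on `E`.
  have hloop : ∀ x ∈ E, p ≤ killedTransition μ E s x x := fun x hx => by
    simpa using killedTransition_le_translate μ (htrans x hx) s 0 0
  refine ⟨fun x hx n _ => ?_, ?_, ?_⟩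
  · have hy : x + n • u ∈ E := hCone.add_mem hx (hCone.nsmul_mem hu n)
    obtain ⟨t, ht, h⟩ := hComm.exists_killedTransition_pos hCone hx hy
    obtain ⟨t', ht', h'⟩ := hComm.exists_killedTransition_pos hCone hy hx
    exact ⟨h.trans_le (killedTransition_le_hittingProb μ E ht _ _),
      h'.trans_le (killedTransition_le_hittingProb μ E ht' _ _)⟩
  · refine tendstoUniformlyOn_log_div_of_exp_le (fun _ _ _ => measureReal_le_one) fun ε hε => ?_
    obtain ⟨c, hc, h⟩ := exists_reaches_nsmul_of_isLatticeCone hComm hCone hMin hu hε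
    refine ⟨p * c, by positivity, fun n x hx => ?_⟩
    have hr := (h n).translate (htrans x hx)
    rw [add_zero] at hr
    rw [mul_assoc]
    exact hr.le_hittingProb hs (hloop x hx) (by positivity)
  · refine tendstoUniformlyOn_log_div_of_exp_le (fun _ _ _ => measureReal_le_one) fun ε hε => ?_
    obtain ⟨c, hc, h⟩ := exists_reaches_zero_of_isLatticeCone hComm hCone hMin hu hε
    refine ⟨p * c, by positivity, fun n x hx => ?_⟩
    have hr := (h n).translate (htrans x hx)
    rw [add_zero] at hr
    rw [mul_assoc]
    exact hr.le_hittingProb hs (hloop _ (htrans x hx _ (hCone.nsmul_mem hu n)))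
      (by positivity)
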